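/- For positive integers $k,m$ let $\mathrm{M}(k,m)=\frac1m\sum_{d\mid m}\mu\left(\frac md\right)k^d$ be the necklace polynomial, where $\mu$ is the Möbius function. An $(M,N;\,m,n)_k$-sub-perfect map is an array with $M\ge 1$ rows and $N\ge 1$ columns of letters from an alphabet of size $k$, read cyclically in both directions, such that every $(m,n)$-pattern ($m$ rows, $n$ columns) occurs at no more than one position. An $(m,n)_k$-de Bruijn ring is an $(m,N;\,m,n)_k$-sub-perfect map such that no $(m,N';\,m,n)_k$-sub-perfect map with $N'>N$ exists. Corollary. Let $k_1,k_2,m,n\ge 2$ be integers and let $\Sigma_1$ and $\Sigma_2$ be alphabets with $|\Sigma_1|=k_1$ and $|\Sigma_2|=k_2$. Then $\mathrm{M}(k_1^n,m)$ and $\mathrm{M}(k_2^m,n)$ are natural numbers, and there exists an $(M,N;\,m,n)_{k_1k_2}$-sub-perfect map over the alphabet $\Sigma_1\times\Sigma_2$ with \[M=\mathrm{lcm}\left(m,\mathrm{M}(k_2^m,n)\right)\quad\text{and}\quad N=\mathrm{lcm}\left(n,\mathrm{M}(k_1^n,m)\right).\] More precisely, there are an $(m,n)_{k_1}$-de Bruijn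 ring $A_1$ over $\Sigma_1$ with $\mathrm{M}(k_1^n,m)$ columns and an $(n,m)_{k_2}$-de Bruijn ring $A_2$ over $\Sigma_2$ with $\mathrm{M}(k_2^m,n)$ columns such that, if $A_2'$ is $A_2$ rotated by $90^\circ$ clockwise (an array with $\mathrm{M}(k_2^m,n)$ rows and $n$ columns), the superposition of $A_1$ and $A_2'$, that is, the array of shape $(M,N)$ over $\Sigma_1\times\Sigma_2$ whose entry at each position is the pair of the entries of the periodically repeated arrays $A_1$ and $A_2'$ at that position, is such a sub-perfect map. -/

import Mathlib

/-- The necklace polynomial `M(k, m) = (1/m) ∑_{d ∣ m} μ(m/d) k^d`, as a rational number. -/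
def necklacePoly (k m : ℕ) : ℚ :=
  (1 / (m : ℚ)) * ∑ d ∈ m.divisors, (ArithmeticFunction.moebius (m / d) : ℚ) * (k : ℚ) ^ d

/-- A pattern of shape `(m, n)` over the alphabet `α`. -/
abbrev Pattern (α : Type*) (m n : ℕ) := Fin m → Fin n → α

/-- A cyclic two-dimensional array of shape `(M, N)` (`M` rows, `N` columns) over the
alphabet `α`: rows are indexed modulo `M` and columns modulo `N`. -/
abbrev CyclicArray (α : Type*) (M N : ℕ) := ZMod M → ZMod N → α

namespace CyclicArray

variable {α β : Type*} {M N M₁ N₁ M₂ N₂ : ℕ}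

/-- The `(m, n)`-pattern read off the cyclic array `A` with upper left corner at `(i, j)`. -/
def window (A : CyclicArray α M N) (m n : ℕ) (i : ZMod M) (j : ZMod N) : Pattern α m n :=
  fun a b => A (i + ((a : ℕ) : ZMod M)) (j + ((b : ℕ) : ZMod N))

/-- `A` is an `(M, N; m, n)_k`-sub-perfect map: it is a cyclic array of shape `(M, N)` over an
alphabet of size `k`, and every `(m, n)`-pattern occurs at no more than one position. -/
def IsSubPerfectMap (A : CyclicArray α M N) (m n k : ℕ) : Prop :=
  0 < M ∧ 0 < N ∧ Nat.card α = k ∧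
    ∀ p : Pattern α m n, {x : ZMod M × ZMod N | A.window m n x.1 x.2 = p}.Subsingleton

/-- `A` is an `(m, n)_k`-de Bruijn ring: an `(m, N; m, n)_k`-sub-perfect map such that there is
no `(m, N'; m, n)_k`-sub-perfect map with `N' > N`. -/
def IsDeBruijnRing {m : ℕ} (A : CyclicArray α m N) (n k : ℕ) : Prop :=
  A.IsSubPerfectMap m n k ∧
    ∀ N' : ℕ, N < N' → ¬ ∃ A' : CyclicArray α m N', A'.IsSubPerfectMap m n k

/-- The (clockwise) rotation of a cyclic array by 90 degrees: row `i` of the result is column `i`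
of `A`, read from bottom to top. -/
def rotate (A : CyclicArray α M N) : CyclicArray α N M :=
  fun i j => A (-1 - j) i

/-- The superposition of two cyclic arrays over the product alphabet, as a cyclic array of shape
`(M, N)`, where `M` is a common multiple of the heights `M₁`, `M₂` and `N` is a common multiple of
the widths `N₁`, `N₂`. Both arrays are repeated periodically: `ZMod.cast` reduces an index
modulo `M` to an index modulo `M₁`, and so on. -/
def superimpose (M N : ℕ) (A : CyclicArray α M₁ N₁) (B : CyclicArray β M₂ N₂) :
    CyclicArray (α × β) M N :=
  fun i j => (A i.cast j.cast, B i.cast j.cast)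

end CyclicArray

/-! In an array with `m` rows, the `(m, n)`-windows at column `j` are the rotations of the cyclic
word formed by the `n` columns from `j` on (`window_eq_window_iff`). So the array is sub-perfect
exactly when these words are aperiodic and pairwise inequivalent under rotation. The width is thus
at most the number of aperiodic necklaces (`width_le`), which Möbius inversion evaluates
(`card_aperiodicNecklace`).

The bound is attained by an Eulerian circuit in a de Bruijn graph modulo rotation: edges are
aperiodic necklaces of `n` columns, vertices are necklaces of `n - 1` columns
(`exists_eulerian_perm`). The circuit is lifted from necklaces to words, and a suitable starting
edge makes the lift close up (`exists_isDeBruijnRing`).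

In the superposition, one layer locates a window modulo `(m, W₁)`, the other modulo `(W₂, n)`;
together they fix its position modulo the least common multiples. -/

/-! ### Eulerian circuits as successor permutations of the edges -/

/-- A finite directed multigraph whose edges can be paired up at each vertex (`σ₀`) and which is
connected from the edge `e₀` has an Eulerian circuit. -/
theorem exists_perm_sameCycle_of_connected {E V : Type*} [Finite E] (src tgt : E → V)
    (σ₀ : Equiv.Perm E) (h₀ : ∀ e, src (σ₀ e) = tgt e) (e₀ : E)
    (hconn : ∀ S : Set E, e₀ ∈ S → (∀ a b, tgt a = src b → (a ∈ S ↔ b ∈ S)) → ∀ e, e ∈ S) :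
    ∃ σ : Equiv.Perm E, (∀ e, src (σ e) = tgt e) ∧ ∀ e, σ.SameCycle e₀ e := by
  classical
  -- Take a successor permutation whose cycle through `e₀` is as long as possible.
  obtain ⟨σ, hσ, hmax⟩ := Set.exists_max_image {σ : Equiv.Perm E | ∀ e, src (σ e) = tgt e}
    (fun σ => {e | σ.SameCycle e₀ e}.ncard) (Set.toFinite _) ⟨σ₀, h₀⟩
  have key : ∀ a a', tgt a = tgt a' → σ.SameCycle e₀ a → σ.SameCycle e₀ a' := by
    intro a a' haa ha
    by_contra ha'
    -- Exchanging the successors of two edges with a common head merges their two cycles, against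
    -- maximality.
    set τ : Equiv.Perm E := σ * Equiv.swap a a' with hτ
    have hτa' : τ a' = σ a := by simp [hτ]
    have hτa : τ a = σ a' := by simp [hτ]
    have hτx : ∀ x, x ≠ a → x ≠ a' → τ x = σ x := fun x h h' => by
      simp [hτ, Equiv.swap_apply_of_ne_of_ne h h']
    have hτmem : ∀ e, src (τ e) = tgt e := by
      intro e
      by_cases h : e = a
      · rw [h, hτa, hσ, haa]
      by_cases h' : e = a'
      · rw [h', hτa', hσ, haa]
      rw [hτx e h h', hσ]
    have hiter : ∀ j : ℕ, τ.SameCycle (σ a) ((σ ^ j) (σ a)) := by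
      intro j
      induction j with
      | zero => exact Equiv.Perm.SameCycle.refl _ _
      | succ j ih =>
        rw [pow_succ', Equiv.Perm.mul_apply]
        by_cases h : (σ ^ j) (σ a) = a
        · rw [h]
        · have h' : (σ ^ j) (σ a) ≠ a' := by
            intro h'
            apply ha'
            rw [← h']
            exact ha.trans (Equiv.Perm.sameCycle_pow_right.2
              (Equiv.Perm.sameCycle_apply_right.2 (Equiv.Perm.SameCycle.refl _ _)))
          rw [← hτx _ h h']
          exact Equiv.Perm.sameCycle_apply_right.2 ih
    have hsub : ∀ x, σ.SameCycle e₀ x → τ.SameCycle (σ a) x := by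
      intro x hx
      have : σ.SameCycle (σ a) x := Equiv.Perm.sameCycle_apply_left.2 (ha.symm.trans hx)
      obtain ⟨j, -, rfl⟩ := this.exists_pow_eq'
      exact hiter j
    have he₀ := (hsub e₀ (Equiv.Perm.SameCycle.refl _ _)).symm
    have hlt : {e | σ.SameCycle e₀ e}.ncard < {e | τ.SameCycle e₀ e}.ncard := by
      apply Set.ncard_lt_ncard _ (Set.toFinite _)
      refine ⟨fun x hx => he₀.trans (hsub x hx), fun h => ha' (h ?_)⟩
      refine he₀.trans ?_
      rw [← hτa']
      exact Equiv.Perm.sameCycle_apply_left.2 (Equiv.Perm.SameCycle.refl _ _)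
    exact absurd (hmax τ hτmem) (not_le.2 hlt)
  refine ⟨σ, hσ, fun e => hconn {e | σ.SameCycle e₀ e} (Equiv.Perm.SameCycle.refl _ _) ?_ e⟩
  intro a b hab
  obtain ⟨b, rfl⟩ := σ.surjective b
  rw [hσ] at hab
  exact ⟨fun ha => Equiv.Perm.sameCycle_apply_right.2 (key a b hab ha),
    fun hb => key b a hab.symm (Equiv.Perm.sameCycle_apply_right.1 hb)⟩

/-! ### Cyclic words, necklaces and aperiodicity -/

section Rotation

/-- The rotation of a cyclic word of length `m` by `g`. -/
def rotateWord {m : ℕ} {X : Type*} (g : ZMod m) (f : ZMod m → X) : ZMod m → X :=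
  fun a => f (a + g)

/-- A cyclic word is aperiodic if no nontrivial rotation fixes it. -/
def IsAperiodicWord {m : ℕ} {X : Type*} (f : ZMod m → X) : Prop :=
  ∀ g, rotateWord g f = f → g = 0

/-- The aperiodic cyclic words of length `m`. -/
abbrev AperiodicWord (m : ℕ) (X : Type*) := {f : ZMod m → X // IsAperiodicWord f}

variable {m : ℕ} {X Y : Type*}

theorem rotateWord_rotateWord (g h : ZMod m) (f : ZMod m → X) :
    rotateWord g (rotateWord h f) = rotateWord (g + h) f := by
  funext a
  simp only [rotateWord, add_assoc]

theorem rotateWord_zero (f : ZMod m → X) : rotateWord 0 f = f := by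
  funext a
  simp only [rotateWord, add_zero]

theorem IsAperiodicWord.rotateWord {f : ZMod m → X} (hf : IsAperiodicWord f) (g : ZMod m) :
    IsAperiodicWord (rotateWord g f) := by
  intro h hh
  apply hf
  have := congrArg (_root_.rotateWord (-g)) hh
  rw [rotateWord_rotateWord, rotateWord_rotateWord, rotateWord_rotateWord] at this
  simpa [rotateWord_zero] using this

theorem IsAperiodicWord.rotateWord_injective {f : ZMod m → X} (hf : IsAperiodicWord f) :
    Function.Injective fun g => _root_.rotateWord g f := by
  intro g h hgh
  have := congrArg (_root_.rotateWord (-h)) hgh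
  simp only [rotateWord_rotateWord, neg_add_cancel, rotateWord_zero] at this
  have := hf _ this
  linear_combination this

theorem IsAperiodicWord.of_comp {f : ZMod m → X} (φ : X → Y) (hf : IsAperiodicWord (φ ∘ f)) :
    IsAperiodicWord f := by
  intro g hg
  apply hf
  funext a
  exact congrArg φ (congrFun hg a)

/-- Two cyclic words are equivalent if they are rotations of each other. -/
def rotationSetoid (m : ℕ) (X : Type*) : Setoid (ZMod m → X) where
  r f f' := ∃ g, rotateWord g f = f'
  iseqv :=
    { refl := fun f => ⟨0, rotateWord_zero f⟩
      symm := by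
        rintro f _ ⟨g, rfl⟩
        exact ⟨-g, by rw [rotateWord_rotateWord, neg_add_cancel, rotateWord_zero]⟩
      trans := by
        rintro f _ _ ⟨g, rfl⟩ ⟨h, rfl⟩
        exact ⟨h + g, (rotateWord_rotateWord h g f).symm⟩ }

/-- Necklaces: cyclic words up to rotation. -/
abbrev Necklace (m : ℕ) (X : Type*) := Quotient (rotationSetoid m X)

/-- Aperiodic necklaces: aperiodic cyclic words up to rotation. -/
abbrev AperiodicNecklace (m : ℕ) (X : Type*) :=
  Quotient ((rotationSetoid m X).comap (Subtype.val : AperiodicWord m X → ZMod m → X))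

/-- Applying a map letter by letter to an aperiodic necklace. -/
def AperiodicNecklace.map (φ : X → Y) : AperiodicNecklace m X → Necklace m Y :=
  Quotient.lift (fun f => Quotient.mk _ (φ ∘ f.1)) (by
    rintro ⟨f, hf⟩ ⟨f', hf'⟩ ⟨g, hg⟩
    apply Quotient.sound
    exact ⟨g, congrArg (φ ∘ ·) (show rotateWord g f = f' from hg)⟩)

/-- A permutation of the alphabet acts on aperiodic necklaces. -/
def AperiodicNecklace.perm (φ : Equiv.Perm X) : Equiv.Perm (AperiodicNecklace m X) :=
  Quotient.congr
    { toFun := fun f => ⟨φ ∘ f.1, IsAperiodicWord.of_comp φ.symm (by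
        simpa [← Function.comp_assoc] using f.2)⟩
      invFun := fun f => ⟨φ.symm ∘ f.1, IsAperiodicWord.of_comp φ (by
        simpa [← Function.comp_assoc] using f.2)⟩
      left_inv := fun f => by ext a; simp
      right_inv := fun f => by ext a; simp }
    (by
      rintro ⟨f, hf⟩ ⟨f', hf'⟩
      constructor
      · rintro ⟨g, hg⟩
        exact ⟨g, congrArg (φ ∘ ·) (show rotateWord g f = f' from hg)⟩
      · rintro ⟨g, hg⟩
        refine ⟨g, ?_⟩
        change rotateWord g f = f'
        funext a
        exact φ.injective (congrFun hg a))

/-- An aperiodic word together with a rotation amount is an aperiodic necklace together with a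
choice of one of its `m` rotations. -/
noncomputable def aperiodicNecklaceProdEquiv (m : ℕ) (X : Type*) :
    AperiodicNecklace m X × ZMod m ≃ AperiodicWord m X :=
  Equiv.ofBijective (fun x => ⟨rotateWord x.2 x.1.out.1, x.1.out.2.rotateWord x.2⟩) (by
    constructor
    · rintro ⟨e, g⟩ ⟨e', g'⟩ h
      have h' : rotateWord g e.out.1 = rotateWord g' e'.out.1 := congrArg Subtype.val h
      have hee : e = e' := by
        rw [← e.out_eq, ← e'.out_eq]
        apply Quotient.sound
        refine (rotationSetoid m X).trans' ⟨g, h'⟩ ((rotationSetoid m X).symm' ⟨g', rfl⟩)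
      subst hee
      exact Prod.ext rfl (e.out.2.rotateWord_injective h')
    · rintro f
      obtain ⟨g, hg⟩ : ∃ g, rotateWord g (Quotient.mk ((rotationSetoid m X).comap _) f).out.1 = f.1 :=
        Quotient.exact (Quotient.mk ((rotationSetoid m X).comap _) f).out_eq
      exact ⟨(_, g), Subtype.ext hg⟩)

theorem mul_card_aperiodicNecklace (m : ℕ) (X : Type*) :
    m * Nat.card (AperiodicNecklace m X) = Nat.card (AperiodicWord m X) := by
  rw [← Nat.card_congr (aperiodicNecklaceProdEquiv m X), Nat.card_prod, Nat.card_zmod, mul_comm]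

end Rotation

/-! ### Counting aperiodic necklaces by Möbius inversion -/

section Counting

open Function

variable {m : ℕ} {X : Type*}

/-- The shift of one-sided infinite words. -/
def shiftWord (x : ℕ → X) : ℕ → X := fun i => x (i + 1)

theorem iterate_shiftWord (j : ℕ) (x : ℕ → X) : shiftWord^[j] x = fun i => x (i + j) := by
  induction j generalizing x with
  | zero => rfl
  | succ j ih =>
    rw [iterate_succ_apply, ih]
    funext i
    simp only [shiftWord]
    rfl

/-- The periodic infinite word repeating a cyclic word. -/
def repeatWord (f : ZMod m → X) : ℕ → X := fun i => f i

theorem isPeriodicPt_repeatWord_iff [NeZero m] (f : ZMod m → X) (j : ℕ) :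
    IsPeriodicPt shiftWord j (repeatWord f) ↔ rotateWord (j : ZMod m) f = f := by
  rw [IsPeriodicPt, IsFixedPt, iterate_shiftWord]
  constructor
  · intro h
    funext a
    have := congrFun h a.val
    simpa [repeatWord, rotateWord] using this
  · intro h
    funext i
    have := congrFun h i
    simpa [repeatWord, rotateWord] using this

/-- Cyclic words of length `m` are the infinite words with period `m`. -/
def cyclicWordEquiv (m : ℕ) [NeZero m] (X : Type*) :
    (ZMod m → X) ≃ {x : ℕ → X // IsPeriodicPt shiftWord m x} where
  toFun f := ⟨repeatWord f, by
    rw [isPeriodicPt_repeatWord_iff, ZMod.natCast_self, rotateWord_zero]⟩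
  invFun x a := x.1 a.val
  left_inv f := by
    funext a
    simp [repeatWord]
  right_inv x := by
    ext i
    have := congrFun (x.2.iterate_mod_apply i) 0
    simp only [iterate_shiftWord, zero_add] at this
    simpa [repeatWord, ZMod.val_natCast] using this

theorem isAperiodicWord_iff_minimalPeriod [NeZero m] (f : ZMod m → X) :
    IsAperiodicWord f ↔ minimalPeriod shiftWord (repeatWord f) = m := by
  constructor
  · intro hf
    apply Nat.dvd_antisymm
    · exact ((cyclicWordEquiv m X) f).2.minimalPeriod_dvd
    · rw [← ZMod.natCast_eq_zero_iff]
      exact hf _ ((isPeriodicPt_repeatWord_iff f _).1 (isPeriodicPt_minimalPeriod _ _))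
  · intro hf g hg
    rw [← ZMod.natCast_zmod_val g, ← isPeriodicPt_repeatWord_iff,
      isPeriodicPt_iff_minimalPeriod_dvd, hf] at hg
    rw [← ZMod.natCast_zmod_val g]
    exact (ZMod.natCast_eq_zero_iff _ _).2 hg

/-- Aperiodic cyclic words of length `m` are the infinite words with minimal period `m`. -/
def aperiodicWordEquiv (m : ℕ) [NeZero m] (X : Type*) :
    AperiodicWord m X ≃ {x : ℕ → X // minimalPeriod shiftWord x = m} where
  toFun f := ⟨repeatWord f.1, (isAperiodicWord_iff_minimalPeriod f.1).1 f.2⟩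
  invFun x :=
    ⟨(cyclicWordEquiv m X).symm ⟨x.1, isPeriodicPt_iff_minimalPeriod_dvd.2 x.2.dvd⟩, by
      rw [isAperiodicWord_iff_minimalPeriod]
      exact (congrArg (minimalPeriod shiftWord) (congrArg Subtype.val
        ((cyclicWordEquiv m X).apply_symm_apply ⟨x.1, _⟩))).trans x.2⟩
  left_inv f := Subtype.ext ((cyclicWordEquiv m X).symm_apply_apply f.1)
  right_inv x := by
    have h := (cyclicWordEquiv m X).apply_symm_apply
      ⟨x.1, isPeriodicPt_iff_minimalPeriod_dvd.2 x.2.dvd⟩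
    exact Subtype.ext (congrArg Subtype.val h :)

/-- A point of period `m` has a minimal period dividing `m`. -/
noncomputable def periodicPtEquivSigma {Y : Type*} (T : Y → Y) (m : ℕ) (hm : m ≠ 0) :
    {x // IsPeriodicPt T m x} ≃ Σ d : m.divisors, {x // minimalPeriod T x = d} where
  toFun x := ⟨⟨minimalPeriod T x.1, Nat.mem_divisors.2 ⟨x.2.minimalPeriod_dvd, hm⟩⟩, x.1, rfl⟩
  invFun y := ⟨y.2.1, isPeriodicPt_iff_minimalPeriod_dvd.2
    (y.2.2.dvd.trans (Nat.dvd_of_mem_divisors y.1.2))⟩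
  left_inv _ := rfl
  right_inv := by
    rintro ⟨⟨d, hd⟩, x, hx⟩
    obtain rfl : minimalPeriod T x = d := hx
    rfl

/-- The shift on `ℕ → X` holds cyclic words of all lengths at once, so its points of period `m` can
be sorted by minimal period. -/
theorem sum_card_minimalPeriod [Finite X] (m : ℕ) (hm : 0 < m) :
    ∑ d ∈ m.divisors, Nat.card {x : ℕ → X // minimalPeriod shiftWord x = d} =
      Nat.card X ^ m := by
  have : NeZero m := ⟨hm.ne'⟩
  have hfin (d : m.divisors) : Finite {x : ℕ → X // minimalPeriod shiftWord x = d} := by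
    have : NeZero d.1 := ⟨(Nat.pos_of_mem_divisors d.2).ne'⟩
    exact Finite.of_equiv _ (aperiodicWordEquiv d X)
  rw [← Finset.sum_coe_sort, ← Nat.card_sigma, ← Nat.card_congr (periodicPtEquivSigma _ m hm.ne'),
    ← Nat.card_congr (cyclicWordEquiv m X), Nat.card_fun, Nat.card_zmod]

theorem card_aperiodicWord [Finite X] (m : ℕ) (hm : 0 < m) :
    (Nat.card (AperiodicWord m X) : ℚ) =
      ∑ d ∈ m.divisors, (ArithmeticFunction.moebius (m / d) : ℚ) * (Nat.card X : ℚ) ^ d := by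
  have : NeZero m := ⟨hm.ne'⟩
  have hsum : ∀ n > 0, ∑ d ∈ n.divisors,
      (Nat.card {x : ℕ → X // minimalPeriod shiftWord x = d} : ℚ) = (Nat.card X : ℚ) ^ n :=
    fun n hn => by exact_mod_cast sum_card_minimalPeriod n hn
  rw [Nat.card_congr (aperiodicWordEquiv m X),
    ← ArithmeticFunction.sum_eq_iff_sum_mul_moebius_eq.1 hsum m hm]
  exact Nat.sum_divisorsAntidiagonal' fun a b =>
    (ArithmeticFunction.moebius a : ℚ) * (Nat.card X : ℚ) ^ b

theorem card_aperiodicNecklace [Finite X] (m : ℕ) (hm : 0 < m) :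
    (Nat.card (AperiodicNecklace m X) : ℚ) = necklacePoly (Nat.card X) m := by
  have hm' : (m : ℚ) ≠ 0 := by exact_mod_cast hm.ne'
  rw [necklacePoly, ← card_aperiodicWord m hm, ← mul_card_aperiodicNecklace]
  push_cast
  field_simp

end Counting

/-! ### De Bruijn rings from Eulerian circuits -/

section DeBruijnRing

variable {m l : ℕ} {α : Type*}

/-- The necklace of all columns but the last one. -/
def AperiodicNecklace.dropLast : AperiodicNecklace m (Fin (l + 1) → α) → Necklace m (Fin l → α) :=
  AperiodicNecklace.map fun p b => p b.castSucc

/-- The necklace of all columns but the first one. -/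
def AperiodicNecklace.tail : AperiodicNecklace m (Fin (l + 1) → α) → Necklace m (Fin l → α) :=
  AperiodicNecklace.map fun p b => p b.succ

/-- The class of an aperiodic word. -/
def AperiodicWord.toNecklace {X : Type*} (f : AperiodicWord m X) : AperiodicNecklace m X :=
  Quotient.mk _ f

/-- Moving the first column to the end pairs incoming with outgoing edges at every vertex. -/
theorem AperiodicNecklace.dropLast_perm_finRotate (e : AperiodicNecklace m (Fin (l + 1) → α)) :
    AperiodicNecklace.dropLast (AperiodicNecklace.perm
      ((finRotate (l + 1)).symm.arrowCongr (Equiv.refl α)) e) = AperiodicNecklace.tail e := by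
  induction e using Quotient.inductionOn with
  | _ f =>
    change Quotient.mk (rotationSetoid m _) _ = Quotient.mk (rotationSetoid m _) _
    congr 1
    funext a b
    simp

/-- Drop the first `t` columns of `f` and append `t` copies of the column `u`. -/
def pushColumns (u : ZMod m → α) (t : ℕ) (f : ZMod m → Fin (l + 1) → α) :
    ZMod m → Fin (l + 1) → α :=
  fun a b => if h : b.1 + t < l + 1 then f a ⟨b.1 + t, h⟩ else u a

theorem pushColumns_zero (u : ZMod m → α) (f : ZMod m → Fin (l + 1) → α) :
    pushColumns u 0 f = f := by
  funext a b
  exact dif_pos b.2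

/-- Once `t > 0` the last column is `u`, and one aperiodic column suffices. -/
theorem isAperiodicWord_pushColumns {u : ZMod m → α} (hu : IsAperiodicWord u) (t : ℕ)
    {f : ZMod m → Fin (l + 1) → α} (hf : IsAperiodicWord f) :
    IsAperiodicWord (pushColumns u t f) := by
  rcases t.eq_zero_or_pos with rfl | ht
  · rwa [pushColumns_zero]
  · refine IsAperiodicWord.of_comp (fun p => p (Fin.last l)) ?_
    convert hu using 1
    funext a
    have : ¬ l + t < l + 1 := by omega
    simp only [pushColumns, Function.comp, Fin.val_last, dif_neg this]

/-- Connectivity: pushing in `u` column by column stays among aperiodic necklaces, and after `l + 1`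
pushes every edge has become the same one. -/
theorem exists_eulerian_perm [NeZero m] [Finite α] {u : ZMod m → α} (hu : IsAperiodicWord u)
    (e₀ : AperiodicNecklace m (Fin (l + 1) → α)) :
    ∃ σ : Equiv.Perm (AperiodicNecklace m (Fin (l + 1) → α)),
      (∀ e, AperiodicNecklace.dropLast (σ e) = AperiodicNecklace.tail e) ∧
        ∀ e, σ.SameCycle e₀ e := by
  refine exists_perm_sameCycle_of_connected _ _ _ AperiodicNecklace.dropLast_perm_finRotate e₀ ?_
  intro S he₀ hS
  have hpush : ∀ (f : AperiodicWord m (Fin (l + 1) → α)) (t : ℕ),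
      f.toNecklace ∈ S ↔ AperiodicWord.toNecklace
        ⟨pushColumns u t f.1, isAperiodicWord_pushColumns hu t f.2⟩ ∈ S := by
    intro f t
    induction t with
    | zero =>
      have : f = ⟨pushColumns u 0 f.1, isAperiodicWord_pushColumns hu 0 f.2⟩ :=
        Subtype.ext (pushColumns_zero u f.1).symm
      rw [← this]
    | succ t ih =>
      rw [ih]
      apply hS
      change Quotient.mk (rotationSetoid m _) _ = Quotient.mk (rotationSetoid m _) _
      congr 1
      funext a b
      simp only [pushColumns, Function.comp, Fin.val_succ, Fin.val_castSucc, add_assoc,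
        add_comm 1 t]
  have hlast : ∀ f f' : ZMod m → Fin (l + 1) → α,
      pushColumns u (l + 1) f = pushColumns u (l + 1) f' := by
    intro f f'
    funext a b
    have : ¬ b.1 + (l + 1) < l + 1 := by omega
    simp only [pushColumns, dif_neg this]
  intro e
  induction e₀ using Quotient.inductionOn with
  | _ f₀ =>
  induction e using Quotient.inductionOn with
  | _ f =>
    have h₀ := (hpush f₀ (l + 1)).1 he₀
    refine (hpush f (l + 1)).2 ?_
    convert h₀ using 3
    exact hlast _ _

/-- Adjacent necklaces overlap only up to rotation; rotating the representative of the second makes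
the overlap exact. -/
theorem AperiodicWord.exists_lift (e : AperiodicNecklace m (Fin (l + 1) → α))
    (p : AperiodicWord m (Fin (l + 1) → α))
    (h : AperiodicNecklace.dropLast e = AperiodicNecklace.tail p.toNecklace) :
    ∃ q : AperiodicWord m (Fin (l + 1) → α), q.toNecklace = e ∧
      ∀ a (b : Fin l), q.1 a b.castSucc = p.1 a b.succ := by
  induction e using Quotient.inductionOn with
  | _ f =>
    obtain ⟨g, hg⟩ : ∃ g, rotateWord g (fun a (b : Fin l) => f.1 a b.castSucc) =
        fun a b => p.1 a b.succ := Quotient.exact h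
    refine ⟨⟨rotateWord g f.1, f.2.rotateWord g⟩, ?_, fun a b => congrFun (congrFun hg a) b⟩
    exact Quotient.sound ((rotationSetoid m _).symm' ⟨g, rfl⟩)

/-- The cyclic word formed by the `n` columns of a cyclic array starting at column `j`. -/
def CyclicArray.columnWord {N : ℕ} (A : CyclicArray α m N) (n : ℕ) (j : ZMod N) :
    ZMod m → Fin n → α :=
  fun a b => A a (j + ((b : ℕ) : ZMod N))

theorem CyclicArray.window_eq_window_iff [NeZero m] {N : ℕ} (A : CyclicArray α m N) (n : ℕ)
    (i i' : ZMod m) (j j' : ZMod N) :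
    A.window m n i j = A.window m n i' j' ↔
      rotateWord i (A.columnWord n j) = rotateWord i' (A.columnWord n j') := by
  constructor
  · intro h
    funext a b
    have := congrFun (congrFun h ⟨a.val, a.val_lt⟩) b
    simpa [CyclicArray.window, rotateWord, CyclicArray.columnWord, add_comm] using this
  · intro h
    funext a b
    have := congrFun (congrFun h (a : ℕ)) b
    simpa [CyclicArray.window, rotateWord, CyclicArray.columnWord, add_comm] using this

/-- The `m * N` windows are distinct aperiodic words, and each necklace accounts for `m` of them. -/
theorem CyclicArray.IsSubPerfectMap.width_le [Finite α] {N n k : ℕ} {A : CyclicArray α m N}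
    (hA : A.IsSubPerfectMap m n k) : N ≤ Nat.card (AperiodicNecklace m (Fin n → α)) := by
  obtain ⟨hm, hN, -, hA⟩ := hA
  have : NeZero m := ⟨hm.ne'⟩
  have hinj : ∀ i i' j j', rotateWord i (A.columnWord n j) = rotateWord i' (A.columnWord n j') →
      (i, j) = (i', j') := fun i i' j j' h =>
    hA (A.window m n i' j') ((A.window_eq_window_iff n i i' j j').2 h) rfl
  have haper : ∀ j, IsAperiodicWord (A.columnWord n j) := fun j g hg =>
    congrArg Prod.fst (hinj g 0 j j (by rw [hg, rotateWord_zero]))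
  have := Nat.card_le_card_of_injective
    (fun x : ZMod m × ZMod N => (⟨rotateWord x.1 (A.columnWord n x.2), (haper x.2).rotateWord x.1⟩ :
      AperiodicWord m (Fin n → α)))
    (fun x y h => hinj _ _ _ _ (congrArg Subtype.val h))
  rw [← mul_card_aperiodicNecklace, Nat.card_prod, Nat.card_zmod, Nat.card_zmod] at this
  exact Nat.le_of_mul_le_mul_left this hm

/-- In a transitive cyclic permutation, the iterates of a point enumerate the whole type. -/
theorem Equiv.Perm.exists_bijective_iterate {E : Type*} [Finite E] (σ : Equiv.Perm E) (e₀ : E)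
    (h : ∀ e, σ.SameCycle e₀ e) :
    0 < Nat.card E ∧ σ^[Nat.card E] e₀ = e₀ ∧
      Function.Bijective fun j : ZMod (Nat.card E) => σ^[j.val] e₀ := by
  have hsurj : ∀ e, ∃ j : ℕ, σ^[j] e₀ = e := by
    intro e
    obtain ⟨j, -, hj⟩ := (h e).exists_pow_eq'
    exact ⟨j, by rw [← hj, Equiv.Perm.iterate_eq_pow]⟩
  have hper : e₀ ∈ Function.periodicPts σ := by
    obtain ⟨j, hj⟩ := hsurj (σ⁻¹ e₀)
    refine ⟨j + 1, j.succ_pos, ?_⟩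
    rw [Function.IsPeriodicPt, Function.IsFixedPt, Function.iterate_succ_apply', hj]
    simp
  obtain ⟨N, hN⟩ : ∃ N, N = Function.minimalPeriod σ e₀ := ⟨_, rfl⟩
  have hpos : 0 < N := hN ▸ Function.minimalPeriod_pos_of_mem_periodicPts hper
  have : NeZero N := ⟨hpos.ne'⟩
  have hbij : Function.Bijective fun j : ZMod N => σ^[j.val] e₀ := by
    constructor
    · intro i j hij
      exact ZMod.val_injective N (Function.iterate_injOn_Iio_minimalPeriod
        (hN ▸ i.val_lt) (hN ▸ j.val_lt) hij)
    · intro e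
      obtain ⟨j, rfl⟩ := hsurj e
      refine ⟨(j : ZMod N), ?_⟩
      simp only [ZMod.val_natCast]
      rw [hN, Function.iterate_mod_minimalPeriod_eq]
  have hcard : N = Nat.card E := by
    rw [← Nat.card_congr (Equiv.ofBijective _ hbij), Nat.card_zmod]
  rw [← hcard]
  exact ⟨hpos, by rw [hN, Function.iterate_minimalPeriod], hbij⟩

theorem exists_isDeBruijnRing [NeZero m] [Finite α] [Nontrivial α] (n : ℕ) (hn : 0 < n) :
    ∃ A : CyclicArray α m (Nat.card (AperiodicNecklace m (Fin n → α))),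
      A.IsDeBruijnRing n (Nat.card α) := by
  classical
  obtain ⟨l, rfl⟩ := Nat.exists_eq_add_one_of_ne_zero hn.ne'
  obtain ⟨z, x, hzx⟩ := exists_pair_ne α
  set u : ZMod m → α := fun a => if a = 0 then x else z with hu_def
  have hu : IsAperiodicWord u := by
    intro g hg
    by_contra hne
    have := congrFun hg 0
    simp only [rotateWord, hu_def, zero_add, if_neg hne, if_pos] at this
    exact hzx this
  -- The last column makes `p₀` aperiodic; the others are constant, hence unchanged by rotation.
  set p₀ : AperiodicWord m (Fin (l + 1) → α) :=
    ⟨fun a b => if b = Fin.last l then u a else z,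
      IsAperiodicWord.of_comp (fun p => p (Fin.last l)) (by
        convert hu using 1
        funext a
        simp)⟩ with hp₀
  have hinit : ∀ a (b : Fin l), p₀.1 a b.castSucc = z := by
    intro a b
    simp [hp₀, Fin.castSucc_ne_last]
  obtain ⟨σ, hσ, hcyc⟩ := exists_eulerian_perm hu p₀.toNecklace
  obtain ⟨hpos, hclose, hbij⟩ := σ.exists_bijective_iterate _ hcyc
  suffices h : ∃ A : CyclicArray α m (Nat.card (AperiodicNecklace m (Fin (l + 1) → α))),
      A.IsSubPerfectMap m (l + 1) (Nat.card α) by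
    obtain ⟨A, hA⟩ := h
    exact ⟨A, hA, fun N' hN' ⟨A', hA'⟩ => absurd hA'.width_le (not_le.2 hN')⟩
  revert hpos hclose hbij
  generalize Nat.card (AperiodicNecklace m (Fin (l + 1) → α)) = N
  intro hpos hclose hbij
  have : NeZero N := ⟨hpos.ne'⟩
  choose next hnext hnext' using fun p : AperiodicWord m (Fin (l + 1) → α) =>
    p.exists_lift (σ p.toNecklace) (hσ _)
  set q : ℕ → AperiodicWord m (Fin (l + 1) → α) := fun j => next^[j] p₀ with hq
  have hqσ : ∀ j, (q j).toNecklace = σ^[j] p₀.toNecklace := by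
    intro j
    induction j with
    | zero => rfl
    | succ j ih =>
      rw [Function.iterate_succ_apply', ← ih, ← hnext]
      simp only [hq, Function.iterate_succ_apply']
  have hqsucc : ∀ j a (b : Fin l), (q (j + 1)).1 a b.castSucc = (q j).1 a b.succ := by
    intro j a b
    simp only [hq, Function.iterate_succ_apply']
    exact hnext' _ a b
  -- The lifted circuit returns to `p₀` only up to a rotation `g`, which the constant columns do not
  -- see; so the array closes.
  have hqN : ∀ a (b : Fin l), (q N).1 a b.castSucc = z := by
    intro a b
    obtain ⟨g, hg⟩ : ∃ g, rotateWord g p₀.1 = (q N).1 :=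
      Quotient.exact ((hqσ N).trans hclose).symm
    rw [← hg]
    exact hinit _ _
  have hstep : ∀ (j : ZMod N) a (b : Fin l),
      (q (j + 1).val).1 a b.castSucc = (q j.val).1 a b.succ := by
    intro j a b
    have hj : (j + 1).val = (j.val + 1) % N := by
      rw [← ZMod.val_natCast]
      simp
    rw [hj]
    rcases (Nat.succ_le_of_lt j.val_lt).lt_or_eq with h | h
    · rw [Nat.mod_eq_of_lt h, hqsucc]
    · have h : j.val + 1 = N := h
      rw [← hqsucc, h, Nat.mod_self, hqN]
      exact hinit a b
  have hcol : ∀ (b : ℕ) (hb : b < l + 1) (j : ZMod N) a,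
      (q (j + b).val).1 a 0 = (q j.val).1 a ⟨b, hb⟩ := by
    intro b
    induction b with
    | zero =>
      intro hb j a
      simp
    | succ b ih =>
      intro hb j a
      have := hstep j a ⟨b, by omega⟩
      rw [Fin.succ_mk, Fin.castSucc_mk] at this
      rw [← this, ← ih]
      push_cast
      ring_nf
  refine ⟨fun i j => (q j.val).1 i 0, Nat.pos_of_neZero m, hpos, rfl, ?_⟩
  rintro p ⟨i, j⟩ rfl ⟨i', j'⟩ h
  have hword : ∀ j, CyclicArray.columnWord (fun i j => (q j.val).1 i 0 : CyclicArray α m N) (l + 1) j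
      = (q j.val).1 := by
    intro j
    funext a b
    exact hcol b b.2 j a
  have h : rotateWord i (q j.val).1 = rotateWord i' (q j'.val).1 := by
    rw [← hword, ← hword]
    exact ((CyclicArray.window_eq_window_iff _ _ _ _ _ _).1 h).symm
  have hj : j = j' := by
    apply hbij.1
    simp only [← hqσ]
    exact Quotient.sound ((rotationSetoid m _).trans' ⟨i, h⟩ ((rotationSetoid m _).symm' ⟨i', rfl⟩))
  subst hj
  exact Prod.ext ((q j.val).2.rotateWord_injective h) rfl

end DeBruijnRing

/-! ### Superposition with a rotated array -/

namespace CyclicArray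

theorem cast_add_natCast {M m : ℕ} (h : m ∣ M) (i : ZMod M) (a : ℕ) :
    ((i + (a : ZMod M)).cast : ZMod m) = i.cast + (a : ZMod m) := by
  rw [ZMod.cast_add h, ZMod.cast_natCast h]

theorem eq_of_cast_eq_cast {m n : ℕ} [NeZero (Nat.lcm m n)] {i i' : ZMod (Nat.lcm m n)}
    (h₁ : (i.cast : ZMod m) = i'.cast) (h₂ : (i.cast : ZMod n) = i'.cast) : i = i' := by
  rw [ZMod.cast_eq_val, ZMod.cast_eq_val, ZMod.natCast_eq_natCast_iff] at h₁ h₂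
  rw [← ZMod.natCast_zmod_val i, ← ZMod.natCast_zmod_val i', ZMod.natCast_eq_natCast_iff]
  rw [Nat.modEq_iff_dvd] at *
  exact Int.coe_lcm_dvd h₁ h₂

/-- The `-1` in `rotate` turns column offset `b` into row offset `n - 1 - b`, which puts the corner
at row `-j`. -/
theorem window_rotate {β : Type*} {n W m : ℕ} (A : CyclicArray β n W) (i : ZMod W) (j : ZMod n)
    (a : Fin m) (b : Fin n) :
    A.rotate.window m n i j a b = A.window n m (-j) i b.rev a := by
  have : (((n - (b.1 + 1) : ℕ)) : ZMod n) = -(b.1 : ZMod n) - 1 := by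
    rw [Nat.cast_sub (by omega), ZMod.natCast_self]
    push_cast
    ring
  simp only [window, rotate, Fin.val_rev, this]
  congr 1
  ring

theorem IsSubPerfectMap.superimpose_rotate {α β : Type*} {k₁ k₂ m n W₁ W₂ : ℕ}
    {A : CyclicArray α m W₁} {B : CyclicArray β n W₂} (hA : A.IsSubPerfectMap m n k₁)
    (hB : B.IsSubPerfectMap n m k₂) :
    (superimpose (Nat.lcm m W₂) (Nat.lcm n W₁) A B.rotate).IsSubPerfectMap m n (k₁ * k₂) := by
  obtain ⟨hm, hW₁, hα, hA⟩ := hA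
  obtain ⟨hn, hW₂, hβ, hB⟩ := hB
  have hM := Nat.lcm_pos hm hW₂
  have hN := Nat.lcm_pos hn hW₁
  have : NeZero (Nat.lcm m W₂) := ⟨hM.ne'⟩
  have : NeZero (Nat.lcm n W₁) := ⟨hN.ne'⟩
  refine ⟨hM, hN, by rw [Nat.card_prod, hα, hβ], ?_⟩
  rintro p ⟨i, j⟩ rfl ⟨i', j'⟩ h
  have hfst : ∀ i j (a : Fin m) (b : Fin n),
      ((superimpose (Nat.lcm m W₂) (Nat.lcm n W₁) A B.rotate).window m n i j a b).1 =
        A.window m n i.cast j.cast a b := by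
    intro i j a b
    simp only [window, superimpose, cast_add_natCast (Nat.dvd_lcm_left m W₂),
      cast_add_natCast (Nat.dvd_lcm_right n W₁)]
  have hsnd : ∀ i j (a : Fin m) (b : Fin n),
      ((superimpose (Nat.lcm m W₂) (Nat.lcm n W₁) A B.rotate).window m n i j a b).2 =
        B.window n m (-j.cast) i.cast b.rev a := by
    intro i j a b
    rw [← window_rotate]
    simp only [window, superimpose, cast_add_natCast (Nat.dvd_lcm_right m W₂),
      cast_add_natCast (Nat.dvd_lcm_left n W₁)]
  have h₁ : ((i.cast, j.cast) : ZMod m × ZMod W₁) = (i'.cast, j'.cast) := by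
    refine hA (A.window m n i'.cast j'.cast) ?_ rfl
    funext a b
    rw [← hfst, ← hfst]
    exact congrArg Prod.fst (congrFun (congrFun h.symm a) b)
  have h₂ : ((-j.cast, i.cast) : ZMod n × ZMod W₂) = (-j'.cast, i'.cast) := by
    refine hB (B.window n m (-j'.cast) i'.cast) ?_ rfl
    funext b a
    have := congrArg Prod.snd (congrFun (congrFun h.symm a) b.rev)
    rwa [hsnd, hsnd, Fin.rev_rev] at this
  rw [Prod.mk.injEq] at h₁ h₂
  rw [eq_of_cast_eq_cast h₁.1 h₂.2, eq_of_cast_eq_cast (neg_injective h₂.1) h₁.2]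

end CyclicArray

theorem mainTheorem6 {α β : Type*} (k₁ k₂ m n : ℕ)
    (hk₁ : 2 ≤ k₁) (hk₂ : 2 ≤ k₂) (hm : 2 ≤ m) (hn : 2 ≤ n)
    (hα : Nat.card α = k₁) (hβ : Nat.card β = k₂) :
    ∃ W₁ W₂ : ℕ, (W₁ : ℚ) = necklacePoly (k₁ ^ n) m ∧ (W₂ : ℚ) = necklacePoly (k₂ ^ m) n ∧
      ∃ (A₁ : CyclicArray α m W₁) (A₂ : CyclicArray β n W₂),
        A₁.IsDeBruijnRing n k₁ ∧ A₂.IsDeBruijnRing m k₂ ∧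
        (CyclicArray.superimpose (Nat.lcm m W₂) (Nat.lcm n W₁) A₁ A₂.rotate).IsSubPerfectMap
          m n (k₁ * k₂) := by
  have : Finite α := Nat.finite_of_card_ne_zero (by omega)
  have : Finite β := Nat.finite_of_card_ne_zero (by omega)
  have : Nontrivial α := Finite.one_lt_card_iff_nontrivial.1 (by omega)
  have : Nontrivial β := Finite.one_lt_card_iff_nontrivial.1 (by omega)
  have : NeZero m := ⟨by omega⟩
  have : NeZero n := ⟨by omega⟩
  obtain ⟨A₁, hA₁⟩ := exists_isDeBruijnRing (m := m) (α := α) n (by omega)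
  obtain ⟨A₂, hA₂⟩ := exists_isDeBruijnRing (m := n) (α := β) m (by omega)
  rw [hα] at hA₁
  rw [hβ] at hA₂
  refine ⟨_, _, ?_, ?_, A₁, A₂, hA₁, hA₂, hA₁.1.superimpose_rotate hA₂.1⟩
  · rw [card_aperiodicNecklace m (by omega), Nat.card_fun, hα, Nat.card_fin]
  · rw [card_aperiodicNecklace n (by omega), Nat.card_fun, hβ, Nat.card_fin]
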